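/- A knot is a subset $K\subset\mathbb{R}^3$ that is ambient isotopic to a simple closed polygon; its knot type $[K]$ is its ambient isotopy class, and $K$ is nontrivial if it is not ambient isotopic to a round circle. The stick index $s[K]$ is the least number of edges of a simple closed polygon in $\mathbb{R}^3$ of knot type $[K]$. A planar stick diagram of $[K]$ is a closed polygon with at least three edges in the plane, in general position (no vertex lies on an edge of which it is not an endpoint, and no three edges have a common point), with over/under information at each self-crossing, that represents $[K]$. The planar stick index $\mathrm{pl}[K]$ is the least number of edges of a planar stick diagram of $[K]$. Theorem. For every nontrivial knot $K$, $$\mathrm{pl}[K]\le s[K]-1.$$ -/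

import Mathlib

/-- The plane, with its Euclidean structure. -/
abbrev PlaneE2 : Type := EuclideanSpace ℝ (Fin 2)

/-- Three-space, with its Euclidean structure. -/
abbrev SpaceE3 : Type := EuclideanSpace ℝ (Fin 3)

/-! ### Ambient isotopy and tame knots -/

/-- Two subsets of three-space are ambient isotopic: there is a level-preserving homeomorphism of
`[0,1] × ℝ³`, i.e. a continuous family of homeomorphisms of `ℝ³`, that is the identity at time `0`
and takes `A` onto `B` at time `1`. -/
def AmbientIsotopic (A B : Set SpaceE3) : Prop :=
  ∃ Φ : (unitInterval × SpaceE3) ≃ₜ (unitInterval × SpaceE3),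
    (∀ p, (Φ p).1 = p.1) ∧ (∀ x, Φ (0, x) = (0, x)) ∧
      (fun x => (Φ (1, x)).2) '' A = B

theorem AmbientIsotopic.refl (A : Set SpaceE3) : AmbientIsotopic A A :=
  ⟨Homeomorph.refl _, fun _ => rfl, fun _ => rfl, by simp⟩

theorem AmbientIsotopic.symm {A B : Set SpaceE3} (h : AmbientIsotopic A B) :
    AmbientIsotopic B A := by
  obtain ⟨Φ, h1, h0, rfl⟩ := h
  have hs : ∀ p, (Φ.symm p).1 = p.1 := fun p => by
    have := h1 (Φ.symm p)
    rw [Φ.apply_symm_apply] at this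
    exact this.symm
  refine ⟨Φ.symm, hs, fun x => ?_, ?_⟩
  · rw [Homeomorph.symm_apply_eq, h0]
  · rw [Set.image_image]
    have : ∀ x : SpaceE3, (Φ.symm (1, (Φ (1, x)).2)).2 = x := fun x => by
      have e : ((1 : unitInterval), (Φ (1, x)).2) = Φ (1, x) := Prod.ext (h1 (1, x)).symm rfl
      rw [e, Φ.symm_apply_apply]
    simp [this]

theorem AmbientIsotopic.trans {A B C : Set SpaceE3} (h : AmbientIsotopic A B)
    (h' : AmbientIsotopic B C) : AmbientIsotopic A C := by
  obtain ⟨Φ, h1, h0, rfl⟩ := h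
  obtain ⟨Ψ, g1, g0, rfl⟩ := h'
  refine ⟨Φ.trans Ψ, fun p => ?_, fun x => ?_, ?_⟩
  · simp [g1, h1]
  · simp [h0, g0]
  · rw [Set.image_image]
    refine Set.image_congr fun x _ => ?_
    have e : ((1 : unitInterval), (Φ (1, x)).2) = Φ (1, x) := Prod.ext (h1 (1, x)).symm rfl
    simp [e]

/-- The point with parameter `t` on the `i`-th edge of the closed polygon with vertices
`v 0, …, v (n-1)`; this edge runs from `v i` to the cyclically next vertex
(`finRotate n i` is `i + 1` modulo `n`). -/
noncomputable def polyEdge {E : Type*} [AddCommGroup E] [Module ℝ E] {n : ℕ} (v : Fin n → E)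
    (i : Fin n) (t : ℝ) : E :=
  AffineMap.lineMap (v i) (v (finRotate n i)) t

/-- A stick knot with `n` sticks: a simple closed polygon in three-space with `n` edges.
Simplicity says that the closed curve, each of its edges being parametrized by `[0,1)`,
is injective. -/
structure StickKnot (n : ℕ) where
  vertex : Fin n → SpaceE3
  three_le : 3 ≤ n
  simple : ∀ i j : Fin n, ∀ s ∈ Set.Ico (0 : ℝ) 1, ∀ t ∈ Set.Ico (0 : ℝ) 1,
    polyEdge vertex i s = polyEdge vertex j t → i = j ∧ s = t

/-- The subset of three-space formed by a stick knot. -/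
def StickKnot.carrier {n : ℕ} (P : StickKnot n) : Set SpaceE3 :=
  {x | ∃ i : Fin n, ∃ t ∈ Set.Icc (0 : ℝ) 1, x = polyEdge P.vertex i t}

/-- A (tame) knot: a subset of three-space that is ambient isotopic to a simple closed polygon.
Its knot type is its ambient isotopy class. -/
def IsTameKnot (K : Set SpaceE3) : Prop :=
  ∃ n : ℕ, ∃ P : StickKnot n, AmbientIsotopic P.carrier K

/-- The round unit circle in the horizontal coordinate plane. -/
def roundCircle : Set SpaceE3 :=
  {x | x 0 ^ 2 + x 1 ^ 2 = 1 ∧ x 2 = 0}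

/-- `K` has the trivial knot type. -/
def IsUnknot (K : Set SpaceE3) : Prop :=
  AmbientIsotopic roundCircle K

/-- The stick index of the knot type of `K`: the least number of sticks of a stick knot of this
type (`⊤` if there is none, which never happens for a tame knot). -/
noncomputable def stickIndex (K : Set SpaceE3) : ℕ∞ :=
  sInf {m : ℕ∞ | ∃ n : ℕ, m = n ∧ ∃ P : StickKnot n, AmbientIsotopic P.carrier K}

theorem IsTameKnot.stickIndex_ne_top {K : Set SpaceE3} (hK : IsTameKnot K) :
    stickIndex K ≠ ⊤ := by
  obtain ⟨n, P, hP⟩ := hK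
  exact ne_top_of_le_ne_top (ENat.natCast_ne_top n) (sInf_le ⟨n, rfl, P, hP⟩)

/-! ### Planar stick diagrams -/

/-- The `i`-th and the `j`-th edge of a closed polygon in the plane cross: they are distinct and
not adjacent, and they meet. -/
def EdgesCross {n : ℕ} (v : Fin n → PlaneE2) (i j : Fin n) : Prop :=
  i ≠ j ∧ i ≠ finRotate n j ∧ j ≠ finRotate n i ∧
    ∃ s ∈ Set.Icc (0 : ℝ) 1, ∃ t ∈ Set.Icc (0 : ℝ) 1, polyEdge v i s = polyEdge v j t

/-- A planar stick diagram with `n` edges: a closed polygon in the plane in general position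
(no vertex lies on an edge that it does not bound, and no three edges have a common point), with
crossing information. Two crossing edges have exactly one common point and cross transversally
there, so the crossing information says which of the two edges is the upper one. -/
structure PlanarStickDiagram (n : ℕ) where
  vertex : Fin n → PlaneE2
  three_le : 3 ≤ n
  vertex_notMem_edge : ∀ i j : Fin n, i ≠ j → i ≠ finRotate n j →
    ∀ t ∈ Set.Icc (0 : ℝ) 1, vertex i ≠ polyEdge vertex j t
  no_triple_point : ∀ i j k : Fin n, i ≠ j → i ≠ k → j ≠ k →
    ∀ r ∈ Set.Icc (0 : ℝ) 1, ∀ s ∈ Set.Icc (0 : ℝ) 1, ∀ t ∈ Set.Icc (0 : ℝ) 1,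
      ¬ (polyEdge vertex i r = polyEdge vertex j s ∧ polyEdge vertex i r = polyEdge vertex k t)
  /-- `isOver i j`: at the crossing of the edges `i` and `j`, edge `i` passes over edge `j`
  (without meaning for pairs of edges that do not cross). -/
  isOver : Fin n → Fin n → Prop
  isOver_iff : ∀ i j : Fin n, EdgesCross vertex i j → (isOver i j ↔ ¬ isOver j i)

namespace PlanarStickDiagram

/-- A system of heights over a diagram: a continuous height function on the closed polygon, given
edge by edge, that respects the crossing information. -/
structure IsHeight {n : ℕ} (D : PlanarStickDiagram n) (h : Fin n → ℝ → ℝ) : Prop where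
  continuousOn : ∀ i, ContinuousOn (h i) (Set.Icc 0 1)
  closed : ∀ i, h i 1 = h (finRotate n i) 0
  crossing : ∀ i j : Fin n, EdgesCross D.vertex i j → D.isOver i j →
    ∀ s ∈ Set.Icc (0 : ℝ) 1, ∀ t ∈ Set.Icc (0 : ℝ) 1,
      polyEdge D.vertex i s = polyEdge D.vertex j t → h j t < h i s

/-- The closed curve in three-space with the given heights that projects vertically to the
diagram. -/
def lift {n : ℕ} (D : PlanarStickDiagram n) (h : Fin n → ℝ → ℝ) : Set SpaceE3 :=
  {x | ∃ i : Fin n, ∃ t ∈ Set.Icc (0 : ℝ) 1,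
    x = !₂[polyEdge D.vertex i t 0, polyEdge D.vertex i t 1, h i t]}

/-- The diagram represents the knot type of `K`: a curve in space that projects to the diagram,
with the prescribed over- and under-passes, has this knot type. (All such curves are ambient
isotopic to each other, by vertical motions.) -/
def Represents {n : ℕ} (D : PlanarStickDiagram n) (K : Set SpaceE3) : Prop :=
  ∃ h : Fin n → ℝ → ℝ, D.IsHeight h ∧ AmbientIsotopic (D.lift h) K

end PlanarStickDiagram

/-- The planar stick index of the knot type of `K`: the least number of edges of a planar stick
diagram that represents this type (`⊤` if there is none). -/
noncomputable def planarStickIndex (K : Set SpaceE3) : ℕ∞ :=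
  sInf {m : ℕ∞ | ∃ n : ℕ, m = n ∧ ∃ D : PlanarStickDiagram n, D.Represents K}

/-! ### Constructing ambient isotopies -/

theorem AmbientIsotopic.of_family (f g : unitInterval → SpaceE3 → SpaceE3)
    (hf : Continuous fun p : unitInterval × SpaceE3 => f p.1 p.2)
    (hg : Continuous fun p : unitInterval × SpaceE3 => g p.1 p.2)
    (hfg : ∀ t x, f t (g t x) = x) (hgf : ∀ t x, g t (f t x) = x) (h0 : ∀ x, f 0 x = x)
    (A : Set SpaceE3) : AmbientIsotopic A (f 1 '' A) :=
  ⟨{ toFun := fun p => (p.1, f p.1 p.2)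
     invFun := fun p => (p.1, g p.1 p.2)
     left_inv := fun p => by simp [hgf]
     right_inv := fun p => by simp [hfg]
     continuous_toFun := continuous_fst.prodMk hf
     continuous_invFun := continuous_fst.prodMk hg },
    fun _ => rfl, fun x => by simp [h0], rfl⟩

theorem ambientIsotopic_translation (c : SpaceE3) (A : Set SpaceE3) :
    AmbientIsotopic A ((fun x => x + c) '' A) := by
  have := AmbientIsotopic.of_family (fun t x => x + (t : ℝ) • c) (fun t x => x - (t : ℝ) • c)
    (by fun_prop) (by fun_prop) (by simp) (by simp) (by simp) A
  simpa using this

theorem ambientIsotopic_transvection (φ : SpaceE3 →L[ℝ] ℝ) (u : SpaceE3) (hu : φ u = 0)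
    (A : Set SpaceE3) : AmbientIsotopic A ((fun x => x + φ x • u) '' A) := by
  have := AmbientIsotopic.of_family (fun t x => x + ((t : ℝ) * φ x) • u)
    (fun t x => x - ((t : ℝ) * φ x) • u)
    (by fun_prop) (by fun_prop) (by simp [hu]) (by simp [hu]) (by simp) A
  simpa using this

theorem norm_sub_le_of_add_smul_eq {F : SpaceE3 → SpaceE3}
    (hF : ∀ x y, ‖F x - F y‖ ≤ (1 / 2) * ‖x - y‖) {s t : ℝ} (ht0 : 0 ≤ t) (ht1 : t ≤ 1)
    {x x' y y' : SpaceE3} (h : x + s • F x = y) (h' : x' + t • F x' = y') :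
    ‖x - x'‖ ≤ 2 * (‖y - y'‖ + |s - t| * ‖F x‖) := by
  have e : x - x' = (y - y') - ((s - t) • F x + t • (F x - F x')) := by
    rw [← h, ← h']; module
  have h1 : ‖x - x'‖ ≤ ‖y - y'‖ + (|s - t| * ‖F x‖ + t * ‖F x - F x'‖) := by
    conv_lhs => rw [e]
    refine (norm_sub_le _ _).trans (add_le_add le_rfl ((norm_add_le _ _).trans ?_))
    simp [norm_smul, abs_of_nonneg ht0]
  have h2 : t * ‖F x - F x'‖ ≤ 1 * ((1 / 2) * ‖x - x'‖) :=
    mul_le_mul ht1 (hF _ _) (norm_nonneg _) zero_le_one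
  linarith

theorem ambientIsotopic_add_of_contracting {F : SpaceE3 → SpaceE3}
    (hF : ∀ x y, ‖F x - F y‖ ≤ (1 / 2) * ‖x - y‖) (A : Set SpaceE3) :
    AmbientIsotopic A ((fun x => x + F x) '' A) := by
  have hL : LipschitzWith (1 / 2) F :=
    LipschitzWith.of_dist_le_mul fun x y => by simpa [dist_eq_norm] using hF x y
  have key : ∀ (t : unitInterval) (y : SpaceE3), ∃ x, x + (t : ℝ) • F x = y := by
    intro t y
    have hc : ContractingWith (1 / 2) (fun x => y - (t : ℝ) • F x) := by
      refine ⟨by rw [← NNReal.coe_lt_coe]; norm_num, LipschitzWith.of_dist_le_mul fun a b => ?_⟩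
      have : (y - (t : ℝ) • F a) - (y - (t : ℝ) • F b) = -((t : ℝ) • (F a - F b)) := by module
      rw [dist_eq_norm, dist_eq_norm, this, norm_neg, norm_smul, Real.norm_of_nonneg t.2.1]
      have := mul_le_mul t.2.2 (hF a b) (norm_nonneg _) zero_le_one
      simpa using this
    refine ⟨hc.fixedPoint, ?_⟩
    have := hc.fixedPoint_isFixedPt
    rw [Function.IsFixedPt] at this
    nth_rewrite 1 [← this]
    simp
  choose g hg using key
  have hcont := hL.continuous
  have := AmbientIsotopic.of_family (fun t x => x + (t : ℝ) • F x) g (by fun_prop) ?_ hg ?_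
    (by simp) A
  · simpa using this
  · rw [continuous_iff_continuousAt]
    rintro ⟨t, y⟩
    rw [ContinuousAt, tendsto_iff_norm_sub_tendsto_zero]
    have hb : Filter.Tendsto (fun p : unitInterval × SpaceE3 =>
        2 * (‖p.2 - y‖ + |(t : ℝ) - p.1| * ‖F (g t y)‖)) (nhds (t, y)) (nhds 0) := by
      have : Continuous (fun p : unitInterval × SpaceE3 =>
        2 * (‖p.2 - y‖ + |(t : ℝ) - p.1| * ‖F (g t y)‖)) := by fun_prop
      simpa using this.tendsto (t, y)
    refine squeeze_zero (fun _ => norm_nonneg _) (fun p => ?_) hb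
    rw [norm_sub_rev, norm_sub_rev p.2]
    exact norm_sub_le_of_add_smul_eq hF p.1.2.1 p.1.2.2 (hg t y) (hg p.1 p.2)
  · intro t x
    have := norm_sub_le_of_add_smul_eq hF t.2.1 t.2.2 (hg t (x + (t : ℝ) • F x))
      (x' := x) rfl
    simpa [sub_eq_zero] using this

/-! ### Closed polygons -/

theorem val_finRotate {n : ℕ} (i : Fin n) :
    (finRotate n i : ℕ) = if (i : ℕ) + 1 = n then 0 else (i : ℕ) + 1 := by
  cases n with
  | zero => exact i.elim0
  | succ n =>
    rw [coe_finRotate]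
    simp [Fin.ext_iff]

theorem finRotate_ne_self {n : ℕ} (hn : 2 ≤ n) (i : Fin n) : finRotate n i ≠ i := by
  rw [Ne, Fin.ext_iff, val_finRotate]
  split_ifs <;> omega

theorem finRotate_finRotate_ne_self {n : ℕ} (hn : 3 ≤ n) (i : Fin n) :
    finRotate n (finRotate n i) ≠ i := by
  rw [Ne, Fin.ext_iff, val_finRotate, val_finRotate]
  split_ifs <;> omega

section polyEdge

variable {E : Type*} [AddCommGroup E] [Module ℝ E] {n : ℕ} (v w : Fin n → E) (i : Fin n)

theorem polyEdge_eq (t : ℝ) : polyEdge v i t = v i + t • (v (finRotate n i) - v i) := by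
  rw [polyEdge, AffineMap.lineMap_apply_module']; abel

@[simp]
theorem polyEdge_zero : polyEdge v i 0 = v i := by simp [polyEdge]

@[simp]
theorem polyEdge_one : polyEdge v i 1 = v (finRotate n i) := by simp [polyEdge]

theorem polyEdge_add (t : ℝ) : polyEdge (v + w) i t = polyEdge v i t + polyEdge w i t := by
  simp only [polyEdge_eq, Pi.add_apply]; module

end polyEdge

/-- The subset of three-space formed by the closed polygon with the given vertices. -/
def polyCarrier {n : ℕ} (v : Fin n → SpaceE3) : Set SpaceE3 :=
  {x | ∃ i : Fin n, ∃ t ∈ Set.Icc (0 : ℝ) 1, x = polyEdge v i t}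

theorem image_polyCarrier {n : ℕ} (f : SpaceE3 → SpaceE3) (v w : Fin n → SpaceE3)
    (h : ∀ i, ∀ t ∈ Set.Icc (0 : ℝ) 1, f (polyEdge v i t) = polyEdge w i t) :
    f '' polyCarrier v = polyCarrier w := by
  ext x
  constructor
  · rintro ⟨_, ⟨i, t, ht, rfl⟩, rfl⟩
    exact ⟨i, t, ht, h i t ht⟩
  · rintro ⟨i, t, ht, rfl⟩
    exact ⟨_, ⟨i, t, ht, rfl⟩, h i t ht⟩

theorem exists_pos_mul_add_le_norm_smul_sub_smul {E : Type*} [NormedAddCommGroup E]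
    [NormedSpace ℝ E] (p q : E)
    (h : ∀ s ∈ Set.Icc (0 : ℝ) 1, ∀ t ∈ Set.Icc (0 : ℝ) 1, s • p = t • q → s = 0 ∧ t = 0) :
    ∃ c > 0, ∀ s t : ℝ, 0 ≤ s → 0 ≤ t → c * (s + t) ≤ ‖s • p - t • q‖ := by
  obtain ⟨r, hr, hmin⟩ := (isCompact_Icc (a := (0 : ℝ)) (b := 1)).exists_isMinOn
    (f := fun r : ℝ => ‖r • p - (1 - r) • q‖) ⟨0, by simp⟩ (by fun_prop)
  refine ⟨‖r • p - (1 - r) • q‖, ?_, fun s t hs ht => ?_⟩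
  · rw [gt_iff_lt, norm_pos_iff, Ne, sub_eq_zero]
    intro e
    have := h r hr (1 - r) ⟨by linarith [hr.2], by linarith [hr.1]⟩ e
    linarith
  · rcases (add_nonneg hs ht).eq_or_lt with h0 | h0
    · rw [← h0]; simp
    · have h1 : s / (s + t) ∈ Set.Icc (0 : ℝ) 1 :=
        ⟨by positivity, by rw [div_le_one h0]; linarith⟩
      have h2 := hmin h1
      simp only [Set.mem_ofPred_eq] at h2
      have e : s • p - t • q = (s + t) • ((s / (s + t)) • p - (1 - s / (s + t)) • q) := by
        have e1 : (s + t) * (s / (s + t)) = s := by field_simp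
        have e2 : (s + t) * (1 - s / (s + t)) = t := by field_simp; ring
        rw [smul_sub, smul_smul, smul_smul, e1, e2]
      rw [e, norm_smul, Real.norm_of_nonneg h0.le, mul_comm]
      exact mul_le_mul_of_nonneg_left h2 h0.le

namespace StickKnot

variable {n : ℕ} (P : StickKnot n)

theorem polyEdge_ne_of_not_adjacent {i j : Fin n} (hij : i ≠ j) (hi : i ≠ finRotate n j)
    (hj : j ≠ finRotate n i) {s t : ℝ} (hs : s ∈ Set.Icc (0 : ℝ) 1)
    (ht : t ∈ Set.Icc (0 : ℝ) 1) : polyEdge P.vertex i s ≠ polyEdge P.vertex j t := by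
  intro h
  have key : ∀ k : Fin n, ∀ r ∈ Set.Icc (0 : ℝ) 1, ∃ r' ∈ Set.Ico (0 : ℝ) 1,
      polyEdge P.vertex k r = polyEdge P.vertex k r' ∨
        r = 1 ∧ r' = 0 ∧ polyEdge P.vertex k r = polyEdge P.vertex (finRotate n k) r' := by
    intro k r hr
    rcases hr.2.eq_or_lt with rfl | hr1
    · exact ⟨0, by simp, Or.inr (by simp)⟩
    · exact ⟨r, ⟨hr.1, hr1⟩, Or.inl rfl⟩
  obtain ⟨s', hs', e | ⟨-, -, e⟩⟩ := key i s hs <;>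
    obtain ⟨t', ht', e' | ⟨-, -, e'⟩⟩ := key j t ht <;>
    rw [e, e'] at h <;> have := (P.simple _ _ _ hs' _ ht' h).1
  · exact hij this
  · exact hi this
  · exact hj this.symm
  · exact hij ((finRotate n).injective this)

theorem vertex_ne_next (i : Fin n) : P.vertex (finRotate n i) ≠ P.vertex i := by
  intro h
  have := P.three_le
  have := P.simple (finRotate n i) i 0 (by simp) 0 (by simp) (by simpa using h)
  exact finRotate_ne_self (by omega) i this.1

theorem exists_bound_self (i : Fin n) : ∃ C > 0, ∀ (d : Fin n → SpaceE3) (ε : ℝ),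
    (∀ k, ‖d k‖ ≤ ε) → ∀ s ∈ Set.Icc (0 : ℝ) 1, ∀ t ∈ Set.Icc (0 : ℝ) 1,
      ‖polyEdge d i s - polyEdge d i t‖ ≤
        C * ε * ‖polyEdge P.vertex i s - polyEdge P.vertex i t‖ := by
  have hl : 0 < ‖P.vertex (finRotate n i) - P.vertex i‖ :=
    norm_pos_iff.2 (sub_ne_zero.2 (P.vertex_ne_next i))
  refine ⟨2 / ‖P.vertex (finRotate n i) - P.vertex i‖, by positivity,
    fun d ε hd s _ t _ => ?_⟩
  have e : ∀ v : Fin n → SpaceE3, polyEdge v i s - polyEdge v i t =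
      (s - t) • (v (finRotate n i) - v i) := fun v => by simp only [polyEdge_eq]; module
  rw [e, e, norm_smul, norm_smul]
  have : ‖d (finRotate n i) - d i‖ ≤ 2 * ε :=
    (norm_sub_le _ _).trans (by linarith [hd i, hd (finRotate n i)])
  calc _ ≤ ‖s - t‖ * (2 * ε) := by gcongr
    _ = _ := by field_simp

theorem exists_bound_far {i j : Fin n} (hij : i ≠ j) (hi : i ≠ finRotate n j)
    (hj : j ≠ finRotate n i) : ∃ C > 0, ∀ (d : Fin n → SpaceE3) (ε : ℝ),
    (∀ k, ‖d k‖ ≤ ε) → ∀ s ∈ Set.Icc (0 : ℝ) 1, ∀ t ∈ Set.Icc (0 : ℝ) 1,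
      ‖polyEdge d i s - polyEdge d j t‖ ≤
        C * ε * ‖polyEdge P.vertex i s - polyEdge P.vertex j t‖ := by
  obtain ⟨c, hc, hmin⟩ : ∃ c > 0, ∀ s ∈ Set.Icc (0 : ℝ) 1, ∀ t ∈ Set.Icc (0 : ℝ) 1,
      c ≤ ‖polyEdge P.vertex i s - polyEdge P.vertex j t‖ := by
    obtain ⟨⟨a, b⟩, hab, hmin⟩ := ((isCompact_Icc (a := (0 : ℝ)) (b := 1)).prod
      (isCompact_Icc (a := (0 : ℝ)) (b := 1))).exists_isMinOn
      (f := fun r : ℝ × ℝ => ‖polyEdge P.vertex i r.1 - polyEdge P.vertex j r.2‖)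
      ⟨(0, 0), by simp⟩ (by simp only [polyEdge_eq]; fun_prop)
    exact ⟨_, norm_pos_iff.2 (sub_ne_zero.2 (P.polyEdge_ne_of_not_adjacent hij hi hj hab.1 hab.2)),
      fun s hs t ht => isMinOn_iff.1 hmin (s, t) (Set.mk_mem_prod hs ht)⟩
  refine ⟨2 / c, by positivity, fun d ε hd s hs t ht => ?_⟩
  have hε : 0 ≤ ε := (norm_nonneg _).trans (hd i)
  have hmin' := hmin s hs t ht
  have hb : ∀ k, ∀ r ∈ Set.Icc (0 : ℝ) 1, ‖polyEdge d k r‖ ≤ ε := fun k r hr => by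
    have := (convex_closedBall (0 : SpaceE3) ε).lineMap_mem
      (mem_closedBall_zero_iff.2 (hd k)) (mem_closedBall_zero_iff.2 (hd (finRotate n k))) hr
    simpa [polyEdge] using this
  calc _ ≤ ε + ε := (norm_sub_le _ _).trans (add_le_add (hb i s hs) (hb j t ht))
    _ = 2 / c * ε * c := by field_simp; ring
    _ ≤ _ := by gcongr

theorem exists_bound_next (i : Fin n) : ∃ C > 0, ∀ (d : Fin n → SpaceE3) (ε : ℝ),
    (∀ k, ‖d k‖ ≤ ε) → ∀ s ∈ Set.Icc (0 : ℝ) 1, ∀ t ∈ Set.Icc (0 : ℝ) 1,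
      ‖polyEdge d i s - polyEdge d (finRotate n i) t‖ ≤
        C * ε * ‖polyEdge P.vertex i s - polyEdge P.vertex (finRotate n i) t‖ := by
  set j := finRotate n i with hj
  set k := finRotate n j with hk
  have h3 := P.three_le
  have e : ∀ (v : Fin n → SpaceE3) (s t : ℝ), polyEdge v i s - polyEdge v j t =
      (1 - s) • (v i - v j) - t • (v k - v j) := fun v s t => by
    simp only [polyEdge_eq, ← hj, ← hk]; module
  obtain ⟨c, hc, hbd⟩ := exists_pos_mul_add_le_norm_smul_sub_smul
    (P.vertex i - P.vertex j) (P.vertex k - P.vertex j) (by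
      intro s hs t ht h
      have h' : polyEdge P.vertex i (1 - s) = polyEdge P.vertex j t := by
        rw [← sub_eq_zero, e, sub_sub_cancel, h, sub_self]
      have hij : j ≠ i := finRotate_ne_self (by omega) i
      have hkj : k ≠ j := finRotate_ne_self (by omega) j
      have hki : k ≠ i := finRotate_finRotate_ne_self h3 i
      rcases hs.1.eq_or_lt with hs0 | hs0
      · refine ⟨hs0.symm, ?_⟩
        rw [← hs0, zero_smul] at h
        rcases smul_eq_zero.1 h.symm with h | h
        · exact h
        · exact absurd (sub_eq_zero.1 h) (P.vertex_ne_next j)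
      · have hs' : 1 - s ∈ Set.Ico (0 : ℝ) 1 := ⟨by linarith [hs.2], by linarith⟩
        exfalso
        rcases ht.2.eq_or_lt with rfl | ht1
        · rw [polyEdge_one, ← hk, ← polyEdge_zero P.vertex k] at h'
          exact hki (P.simple _ _ _ hs' _ (by simp) h').1.symm
        · exact hij (P.simple _ _ _ hs' _ ⟨ht.1, ht1⟩ h').1.symm)
  refine ⟨2 / c, by positivity, fun d ε hd s hs t ht => ?_⟩
  have hε : 0 ≤ ε := (norm_nonneg _).trans (hd i)
  have h1 : ∀ a b, ‖d a - d b‖ ≤ 2 * ε := fun a b =>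
    (norm_sub_le _ _).trans (by linarith [hd a, hd b])
  have hs1 : 0 ≤ 1 - s := by linarith [hs.2]
  have := hbd (1 - s) t hs1 ht.1
  rw [e, e]
  calc _ ≤ (1 - s) * (2 * ε) + t * (2 * ε) := by
        refine (norm_sub_le _ _).trans ?_
        rw [norm_smul, norm_smul, Real.norm_of_nonneg hs1, Real.norm_of_nonneg ht.1]
        have := ht.1
        gcongr <;> exact h1 _ _
    _ = 2 / c * ε * (c * (1 - s + t)) := by field_simp
    _ ≤ _ := by gcongr

theorem exists_bound : ∃ C > 0, ∀ (d : Fin n → SpaceE3) (ε : ℝ),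
    (∀ k, ‖d k‖ ≤ ε) → ∀ i j, ∀ s ∈ Set.Icc (0 : ℝ) 1, ∀ t ∈ Set.Icc (0 : ℝ) 1,
      ‖polyEdge d i s - polyEdge d j t‖ ≤
        C * ε * ‖polyEdge P.vertex i s - polyEdge P.vertex j t‖ := by
  have key : ∀ p : Fin n × Fin n, ∃ C > 0, ∀ (d : Fin n → SpaceE3) (ε : ℝ),
      (∀ k, ‖d k‖ ≤ ε) → ∀ s ∈ Set.Icc (0 : ℝ) 1, ∀ t ∈ Set.Icc (0 : ℝ) 1,
      ‖polyEdge d p.1 s - polyEdge d p.2 t‖ ≤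
        C * ε * ‖polyEdge P.vertex p.1 s - polyEdge P.vertex p.2 t‖ := by
    rintro ⟨i, j⟩
    by_cases hij : i = j
    · subst hij; exact P.exists_bound_self i
    by_cases hj : j = finRotate n i
    · subst hj; exact P.exists_bound_next i
    by_cases hi : i = finRotate n j
    · subst hi
      obtain ⟨C, hC, h⟩ := P.exists_bound_next j
      refine ⟨C, hC, fun d ε hd s hs t ht => ?_⟩
      have := h d ε hd t ht s hs
      rwa [norm_sub_rev, norm_sub_rev (polyEdge P.vertex _ _)] at this
    · exact P.exists_bound_far hij hi hj
  choose C hC h using key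
  refine ⟨∑ p, C p + 1, by have := Finset.sum_nonneg fun p (_ : p ∈ Finset.univ) => (hC p).le
                           linarith, fun d ε hd i j s hs t ht => ?_⟩
  refine (h (i, j) d ε hd s hs t ht).trans ?_
  have hε : 0 ≤ ε := (norm_nonneg _).trans (hd i)
  have : C (i, j) ≤ ∑ p, C p + 1 :=
    (Finset.single_le_sum (fun p _ => (hC p).le) (Finset.mem_univ (i, j))).trans (by simp)
  gcongr

/-- Polygons close to a stick knot are stick knots of the same knot type. -/
theorem exists_stable : ∃ ε > 0, ∀ w : Fin n → SpaceE3, (∀ k, ‖w k - P.vertex k‖ ≤ ε) →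
    (∃ Q : StickKnot n, Q.vertex = w) ∧ AmbientIsotopic P.carrier (polyCarrier w) := by
  obtain ⟨C, hC, hbound⟩ := P.exists_bound
  set L : ℝ := (lipschitzExtensionConstant SpaceE3 : ℝ) with hL
  have hL0 : 0 ≤ L := NNReal.coe_nonneg _
  refine ⟨1 / (2 * (L + 1) * C), by positivity, fun w hw => ?_⟩
  obtain ⟨d, rfl⟩ : ∃ d, w = P.vertex + d := ⟨w - P.vertex, by simp⟩
  simp only [Pi.add_apply, add_sub_cancel_left] at hw
  have hb : ∀ i j, ∀ s ∈ Set.Icc (0 : ℝ) 1, ∀ t ∈ Set.Icc (0 : ℝ) 1,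
      ‖polyEdge d i s - polyEdge d j t‖ ≤
        1 / (2 * (L + 1)) * ‖polyEdge P.vertex i s - polyEdge P.vertex j t‖ := by
    intro i j s hs t ht
    refine (hbound d _ hw i j s hs t ht).trans (le_of_eq ?_)
    field_simp
  have hhalf : 1 / (2 * (L + 1)) ≤ 1 / 2 := by
    gcongr; linarith
  let γ : Fin n × Set.Icc (0 : ℝ) 1 → SpaceE3 := fun p => polyEdge P.vertex p.1 p.2
  let δ : Fin n × Set.Icc (0 : ℝ) 1 → SpaceE3 := fun p => polyEdge d p.1 p.2
  have hfac : Function.FactorsThrough δ γ := by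
    rintro ⟨i, s⟩ ⟨j, t⟩ h
    have := hb i j s s.2 t t.2
    have h0 : polyEdge P.vertex i s = polyEdge P.vertex j t := h
    rw [h0, sub_self, norm_zero, mul_zero] at this
    exact sub_eq_zero.1 (norm_le_zero_iff.1 this)
  let f : SpaceE3 → SpaceE3 := Function.extend γ δ 0
  have hf : ∀ i, ∀ t ∈ Set.Icc (0 : ℝ) 1, f (polyEdge P.vertex i t) = polyEdge d i t :=
    fun i t ht => hfac.extend_apply 0 (i, ⟨t, ht⟩)
  have hlip : LipschitzOnWith (Real.toNNReal (1 / (2 * (L + 1)))) f (polyCarrier P.vertex) := by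
    refine LipschitzOnWith.of_dist_le_mul ?_
    rintro _ ⟨i, s, hs, rfl⟩ _ ⟨j, t, ht, rfl⟩
    rw [hf i s hs, hf j t ht, dist_eq_norm, dist_eq_norm, Real.coe_toNNReal _ (by positivity)]
    exact hb i j s hs t ht
  obtain ⟨F, hF, hFf⟩ := hlip.extend_finite_dimension
  have hF' : ∀ x y, ‖F x - F y‖ ≤ (1 / 2) * ‖x - y‖ := by
    intro x y
    have := hF.dist_le_mul x y
    rw [dist_eq_norm, dist_eq_norm, NNReal.coe_mul, Real.coe_toNNReal _ (by positivity)] at this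
    refine this.trans ?_
    gcongr
    rw [← hL, mul_one_div, div_le_div_iff₀ (by positivity) (by norm_num)]
    linarith
  constructor
  · refine ⟨⟨P.vertex + d, P.three_le, fun i j s hs t ht h => ?_⟩, rfl⟩
    have hs' := Set.Ico_subset_Icc_self hs
    have ht' := Set.Ico_subset_Icc_self ht
    refine P.simple i j s hs t ht ?_
    have h1 := hb i j s hs' t ht'
    rw [polyEdge_add, polyEdge_add] at h
    have e : polyEdge d i s - polyEdge d j t =
        -(polyEdge P.vertex i s - polyEdge P.vertex j t) := by
      rw [← sub_eq_zero] at h ⊢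
      rw [← h]; abel
    rw [e, norm_neg] at h1
    have h2 := mul_le_mul_of_nonneg_right hhalf
      (norm_nonneg (polyEdge P.vertex i s - polyEdge P.vertex j t))
    exact sub_eq_zero.1 (norm_le_zero_iff.1 (by linarith))
  · have := ambientIsotopic_add_of_contracting hF' (polyCarrier P.vertex)
    rwa [image_polyCarrier _ P.vertex (P.vertex + d)] at this
    intro i t ht
    rw [polyEdge_add, ← hFf ⟨i, t, ht, rfl⟩, hf i t ht]

end StickKnot

/-! ### General position in the plane -/

/-- Twice the signed area of a triangle in the plane. -/
def triangleDet (a b c : PlaneE2) : ℝ :=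
  (b 0 - a 0) * (c 1 - a 1) - (b 1 - a 1) * (c 0 - a 0)

/-- The determinant of the equations of the lines `aa'`, `bb'`, `cc'`; it vanishes if these lines
have a common point. -/
def concurrencyDet (a a' b b' c c' : PlaneE2) : ℝ :=
  (a 1 - a' 1) * ((b' 0 - b 0) * (c 0 * c' 1 - c 1 * c' 0) -
      (c' 0 - c 0) * (b 0 * b' 1 - b 1 * b' 0)) -
    (a' 0 - a 0) * ((b 1 - b' 1) * (c 0 * c' 1 - c 1 * c' 0) -
      (c 1 - c' 1) * (b 0 * b' 1 - b 1 * b' 0)) +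
    (a 0 * a' 1 - a 1 * a' 0) * ((b 1 - b' 1) * (c' 0 - c 0) - (c 1 - c' 1) * (b' 0 - b 0))

/-- No three points of the family are collinear, and no three lines through disjoint pairs of
points are concurrent. -/
structure InGeneralPosition {m : ℕ} (w : Fin m → PlaneE2) : Prop where
  triangleDet_ne : ∀ σ : Fin 3 → Fin m, Function.Injective σ →
    triangleDet (w (σ 0)) (w (σ 1)) (w (σ 2)) ≠ 0
  concurrencyDet_ne : ∀ σ : Fin 6 → Fin m, Function.Injective σ →
    concurrencyDet (w (σ 0)) (w (σ 1)) (w (σ 2)) (w (σ 3)) (w (σ 4)) (w (σ 5)) ≠ 0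

theorem analyticAt_coord {m : ℕ} (i : Fin m) (k : Fin 2) (w : Fin m → PlaneE2) :
    AnalyticAt ℝ (fun w : Fin m → PlaneE2 => w i k) w :=
  ((EuclideanSpace.proj (𝕜 := ℝ) k).comp
    (ContinuousLinearMap.proj (R := ℝ) (φ := fun _ : Fin m => PlaneE2) i)).analyticAt w

theorem dense_ne_zero_of_analytic {E : Type*} [NormedAddCommGroup E] [NormedSpace ℝ E]
    {f : E → ℝ} (hf : ∀ x, AnalyticAt ℝ f x) {u : E} (hu : f u ≠ 0) : Dense {x | f x ≠ 0} := by
  intro x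
  by_contra hx
  refine hu ?_
  have h0 : f =ᶠ[nhds x] 0 := by
    rw [mem_closure_iff_frequently, Filter.not_frequently] at hx
    filter_upwards [hx] with y hy
    simpa using hy
  exact (AnalyticOnNhd.eqOn_zero_of_preconnected_of_eventuallyEq_zero
    (fun y _ => hf y : AnalyticOnNhd ℝ f Set.univ) isPreconnected_univ (Set.mem_univ x) h0)
    (Set.mem_univ u)

theorem analyticAt_triangleDet {m : ℕ} (σ : Fin 3 → Fin m) (w : Fin m → PlaneE2) :
    AnalyticAt ℝ (fun w : Fin m → PlaneE2 => triangleDet (w (σ 0)) (w (σ 1)) (w (σ 2))) w := by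
  have h := fun i k => analyticAt_coord (m := m) i k w
  unfold triangleDet
  fun_prop

theorem analyticAt_concurrencyDet {m : ℕ} (σ : Fin 6 → Fin m) (w : Fin m → PlaneE2) :
    AnalyticAt ℝ (fun w : Fin m → PlaneE2 => concurrencyDet (w (σ 0)) (w (σ 1)) (w (σ 2))
      (w (σ 3)) (w (σ 4)) (w (σ 5))) w := by
  have h := fun i k => analyticAt_coord (m := m) i k w
  unfold concurrencyDet
  fun_prop

theorem dense_inGeneralPosition (m : ℕ) : Dense {w : Fin m → PlaneE2 | InGeneralPosition w} := by
  have h3 : Dense (⋂ σ : {σ : Fin 3 → Fin m // Function.Injective σ},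
      {w : Fin m → PlaneE2 | triangleDet (w (σ.1 0)) (w (σ.1 1)) (w (σ.1 2)) ≠ 0}) := by
    refine dense_iInter_of_isOpen (fun σ => ?_) fun σ => ?_
    · exact isOpen_ne_fun (continuous_iff_continuousAt.2 fun w =>
        (analyticAt_triangleDet σ.1 w).continuousAt) continuous_const
    · refine dense_ne_zero_of_analytic (analyticAt_triangleDet σ.1)
        (u := Function.extend σ.1 ![!₂[0, 0], !₂[1, 0], !₂[0, 1]] 0) ?_
      simp only [σ.2.extend_apply]
      simp [triangleDet]
  have h6 : Dense (⋂ σ : {σ : Fin 6 → Fin m // Function.Injective σ},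
      {w : Fin m → PlaneE2 | concurrencyDet (w (σ.1 0)) (w (σ.1 1)) (w (σ.1 2)) (w (σ.1 3))
        (w (σ.1 4)) (w (σ.1 5)) ≠ 0}) := by
    refine dense_iInter_of_isOpen (fun σ => ?_) fun σ => ?_
    · exact isOpen_ne_fun (continuous_iff_continuousAt.2 fun w =>
        (analyticAt_concurrencyDet σ.1 w).continuousAt) continuous_const
    · refine dense_ne_zero_of_analytic (analyticAt_concurrencyDet σ.1)
        (u := Function.extend σ.1
          ![!₂[0, 0], !₂[0, 1], !₂[0, 0], !₂[1, 0], !₂[1, 0], !₂[0, 1]] 0) ?_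
      simp only [σ.2.extend_apply]
      simp [concurrencyDet]
  have ho : IsOpen (⋂ σ : {σ : Fin 3 → Fin m // Function.Injective σ},
      {w : Fin m → PlaneE2 | triangleDet (w (σ.1 0)) (w (σ.1 1)) (w (σ.1 2)) ≠ 0}) :=
    isOpen_iInter_of_finite fun σ => isOpen_ne_fun (continuous_iff_continuousAt.2 fun w =>
        (analyticAt_triangleDet σ.1 w).continuousAt) continuous_const
  refine (h3.inter_of_isOpen_left h6 ho).mono ?_
  rintro w ⟨hw3, hw6⟩
  rw [Set.mem_iInter] at hw3 hw6
  exact ⟨fun σ hσ => hw3 ⟨σ, hσ⟩, fun σ hσ => hw6 ⟨σ, hσ⟩⟩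

theorem exists_inGeneralPosition_near {m : ℕ} (w : Fin m → PlaneE2) {ε : ℝ} (hε : 0 < ε) :
    ∃ w' : Fin m → PlaneE2, InGeneralPosition w' ∧ ∀ i, ‖w' i - w i‖ < ε := by
  obtain ⟨w', hw', hd⟩ := (dense_inGeneralPosition m).exists_dist_lt w hε
  refine ⟨w', hw', fun i => ?_⟩
  rw [← dist_eq_norm, dist_comm]
  exact (dist_le_pi_dist w w' i).trans_lt hd

theorem polyEdge_apply {ι : Type*} {n : ℕ} (v : Fin n → EuclideanSpace ℝ ι) (i : Fin n) (t : ℝ)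
    (k : ι) : polyEdge v i t k = v i k + t * (v (finRotate n i) k - v i k) := by
  simp [polyEdge_eq]

theorem triangleDet_polyEdge {n : ℕ} (v : Fin n → PlaneE2) (j : Fin n) (t : ℝ) :
    triangleDet (v j) (v (finRotate n j)) (polyEdge v j t) = 0 := by
  simp only [triangleDet, polyEdge_apply]; ring

theorem concurrencyDet_eq_zero {a a' b b' c c' x : PlaneE2} (ha : triangleDet a a' x = 0)
    (hb : triangleDet b b' x = 0) (hc : triangleDet c c' x = 0) :
    concurrencyDet a a' b b' c c' = 0 := by
  unfold triangleDet at ha hb hc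
  unfold concurrencyDet
  linear_combination
    ((b 1 - b' 1) * (c' 0 - c 0) - (c 1 - c' 1) * (b' 0 - b 0)) * ha +
    ((a' 0 - a 0) * (c 1 - c' 1) - (a 1 - a' 1) * (c' 0 - c 0)) * hb +
    ((a 1 - a' 1) * (b' 0 - b 0) - (a' 0 - a 0) * (b 1 - b' 1)) * hc

namespace InGeneralPosition

variable {m : ℕ} {w : Fin m → PlaneE2}

theorem triangleDet_ne' (hw : InGeneralPosition w) {i j k : Fin m} (hij : i ≠ j)
    (hik : i ≠ k) (hjk : j ≠ k) : triangleDet (w i) (w j) (w k) ≠ 0 := by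
  refine hw.triangleDet_ne ![i, j, k] ?_
  intro a b h
  revert h
  fin_cases a <;> fin_cases b <;> simp [hij, hik, hjk, hij.symm, hik.symm, hjk.symm]

theorem vertex_ne_polyEdge (hw : InGeneralPosition w) (hm : 3 ≤ m) {i j : Fin m}
    (hij : i ≠ j) (hij' : i ≠ finRotate m j) (t : ℝ) : w i ≠ polyEdge w j t := by
  intro h
  have := hw.triangleDet_ne' (finRotate_ne_self (by omega) j).symm hij.symm hij'.symm
  exact this (by rw [h]; exact triangleDet_polyEdge w j t)

theorem polyEdge_next_eq (hw : InGeneralPosition w) (hm : 3 ≤ m) {i : Fin m} {r s : ℝ}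
    (h : polyEdge w i r = polyEdge w (finRotate m i) s) :
    polyEdge w i r = w (finRotate m i) := by
  have hne := hw.triangleDet_ne' (finRotate_ne_self (by omega) i).symm
    (finRotate_finRotate_ne_self hm i).symm (finRotate_ne_self (by omega) (finRotate m i)).symm
  have h0 := congrArg (fun x : PlaneE2 => x 0) h
  have h1 := congrArg (fun x : PlaneE2 => x 1) h
  simp only [polyEdge_apply] at h0 h1
  have hr : (1 - r) *
      triangleDet (w i) (w (finRotate m i)) (w (finRotate m (finRotate m i))) = 0 := by
    unfold triangleDet
    linear_combination
      (w (finRotate m (finRotate m i)) 0 - w (finRotate m i) 0) * h1 -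
      (w (finRotate m (finRotate m i)) 1 - w (finRotate m i) 1) * h0
  have : r = 1 := by
    rcases mul_eq_zero.1 hr with h | h
    · linarith
    · exact absurd h hne
  rw [this, polyEdge_one]

theorem no_triple_point_of_adjacent (hw : InGeneralPosition w) (hm : 3 ≤ m) {i k : Fin m}
    (hik : i ≠ k) (hjk : finRotate m i ≠ k) {r s t : ℝ}
    (h : polyEdge w i r = polyEdge w (finRotate m i) s) :
    polyEdge w i r ≠ polyEdge w k t := by
  rw [hw.polyEdge_next_eq hm h]
  exact hw.vertex_ne_polyEdge hm hjk ((finRotate m).injective.ne hik) t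

theorem no_triple_point (hw : InGeneralPosition w) (hm : 3 ≤ m) {i j k : Fin m} (hij : i ≠ j)
    (hik : i ≠ k) (hjk : j ≠ k) {r s t : ℝ} (h1 : polyEdge w i r = polyEdge w j s)
    (h2 : polyEdge w i r = polyEdge w k t) : False := by
  have h3 : polyEdge w j s = polyEdge w k t := h1.symm.trans h2
  by_cases a1 : finRotate m i = j
  · subst a1; exact hw.no_triple_point_of_adjacent hm hik hjk h1 h2
  by_cases a2 : finRotate m j = i
  · subst a2; exact hw.no_triple_point_of_adjacent hm hjk hik h1.symm h3
  by_cases a3 : finRotate m i = k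
  · subst a3; exact hw.no_triple_point_of_adjacent hm hij hjk.symm h2 h1
  by_cases a4 : finRotate m k = i
  · subst a4; exact hw.no_triple_point_of_adjacent hm hjk.symm hij h2.symm h3.symm
  by_cases a5 : finRotate m j = k
  · subst a5; exact hw.no_triple_point_of_adjacent hm hij.symm hik.symm h3 h1.symm
  by_cases a6 : finRotate m k = j
  · subst a6; exact hw.no_triple_point_of_adjacent hm hik.symm hij.symm h3.symm h2.symm
  have e := (finRotate m).injective
  have ni := finRotate_ne_self (by omega : 2 ≤ m) i
  have nj := finRotate_ne_self (by omega : 2 ≤ m) j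
  have nk := finRotate_ne_self (by omega : 2 ≤ m) k
  refine hw.concurrencyDet_ne ![i, finRotate m i, j, finRotate m j, k, finRotate m k] ?_
    (concurrencyDet_eq_zero (x := polyEdge w i r) ?_ ?_ ?_)
  · intro a b h
    revert h
    fin_cases a <;> fin_cases b <;> simp [-finRotate_apply, e.eq_iff, *, Ne.symm hij, Ne.symm hik,
      Ne.symm hjk, Ne.symm ni, Ne.symm nj, Ne.symm nk, Ne.symm a1, Ne.symm a2, Ne.symm a3,
      Ne.symm a4, Ne.symm a5, Ne.symm a6]
  · exact triangleDet_polyEdge w i r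
  · rw [h1]; exact triangleDet_polyEdge w j s
  · rw [h2]; exact triangleDet_polyEdge w k t

theorem crossing_unique (hw : InGeneralPosition w) (hm : 3 ≤ m) {i j : Fin m} (hij : i ≠ j)
    (hj : j ≠ finRotate m i) {s t s' t' : ℝ} (h : polyEdge w i s = polyEdge w j t)
    (h' : polyEdge w i s' = polyEdge w j t') : s = s' ∧ t = t' := by
  have hne := hw.triangleDet_ne' (finRotate_ne_self (by omega) i).symm hij hj.symm
  have h0 := congrArg (fun x : PlaneE2 => x 0) h
  have h1 := congrArg (fun x : PlaneE2 => x 1) h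
  have h0' := congrArg (fun x : PlaneE2 => x 0) h'
  have h1' := congrArg (fun x : PlaneE2 => x 1) h'
  simp only [polyEdge_apply] at h0 h1 h0' h1'
  unfold triangleDet at hne
  generalize w (finRotate m i) 0 = a0 at *
  generalize w (finRotate m i) 1 = a1 at *
  generalize w (finRotate m j) 0 = b0 at *
  generalize w (finRotate m j) 1 = b1 at *
  have hD : (a0 - w i 0) * (b1 - w j 1) - (a1 - w i 1) * (b0 - w j 0) ≠ 0 := by
    intro hD
    exact hne (by linear_combination (a1 - w i 1) * h0 - (a0 - w i 0) * h1 - t * hD)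
  constructor
  · refine sub_eq_zero.1 ((mul_eq_zero.1 ?_).resolve_right hD)
    linear_combination (b1 - w j 1) * (h0 - h0') - (b0 - w j 0) * (h1 - h1')
  · refine sub_eq_zero.1 ((mul_eq_zero.1 ?_).resolve_right hD)
    linear_combination (a1 - w i 1) * (h0 - h0') - (a0 - w i 0) * (h1 - h1')

end InGeneralPosition

/-! ### Triangles are unknotted -/

theorem ambientIsotopic_polyCarrier_translation {n : ℕ} (v : Fin n → SpaceE3) (c : SpaceE3) :
    AmbientIsotopic (polyCarrier v) (polyCarrier fun i => v i + c) := by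
  have := ambientIsotopic_translation c (polyCarrier v)
  rwa [image_polyCarrier _ v (fun i => v i + c)] at this
  intro i t _
  simp only [polyEdge_eq]; module

theorem ambientIsotopic_polyCarrier_transvection {n : ℕ} (v : Fin n → SpaceE3)
    (φ : SpaceE3 →L[ℝ] ℝ) (u : SpaceE3) (hu : φ u = 0) :
    AmbientIsotopic (polyCarrier v) (polyCarrier fun i => v i + φ (v i) • u) := by
  have := ambientIsotopic_transvection φ u hu (polyCarrier v)
  rwa [image_polyCarrier _ v (fun i => v i + φ (v i) • u)] at this
  intro i t _
  simp only [polyEdge_eq, map_add, map_smul, map_sub, smul_eq_mul]; module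

theorem exists_transvection {p q q' : SpaceE3} (h : LinearIndependent ℝ ![q', p, q]) :
    ∃ (φ : SpaceE3 →L[ℝ] ℝ) (u : SpaceE3), φ u = 0 ∧ φ p = 0 ∧ q + φ q • u = q' := by
  let b := basisOfLinearIndependentOfCardEqFinrank h (by simp)
  let φ : SpaceE3 →ₗ[ℝ] ℝ := b.constr ℝ ![1, 0, 1]
  have hb : ∀ i, φ (![q', p, q] i) = (![1, 0, 1] : Fin 3 → ℝ) i := fun i => by
    rw [← b.constr_basis ℝ ![1, 0, 1] i, coe_basisOfLinearIndependentOfCardEqFinrank]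
  have h0 : φ q' = 1 := hb 0
  have h1 : φ p = 0 := hb 1
  have h2 : φ q = 1 := hb 2
  refine ⟨LinearMap.toContinuousLinearMap φ, q' - q, ?_, ?_, ?_⟩ <;> simp [h0, h1, h2]

theorem exists_notMem_span_pairs {ι : Type*} [Finite ι] (a b : ι → SpaceE3) :
    ∃ x, ∀ i, x ∉ Submodule.span ℝ (Set.range ![a i, b i]) := by
  by_contra! h
  obtain ⟨i, hi⟩ := Subspace.exists_eq_top_of_iUnion_eq_univ (k := ℝ)
    (p := fun i => Submodule.span ℝ (Set.range ![a i, b i]))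
    (Set.eq_univ_of_forall fun x => Set.mem_iUnion.2 (h x))
  have h1 : Module.finrank ℝ (Submodule.span ℝ (Set.range ![a i, b i])) ≤ Fintype.card (Fin 2) :=
    finrank_range_le_card ![a i, b i]
  rw [hi, finrank_top] at h1
  simp at h1

theorem ambientIsotopic_triangle_right {p q q' : SpaceE3} (h : LinearIndependent ℝ ![p, q])
    (hq' : q' ∉ Submodule.span ℝ (Set.range ![p, q])) :
    AmbientIsotopic (polyCarrier ![0, p, q]) (polyCarrier ![0, p, q']) := by
  obtain ⟨φ, u, hu, hp, hq⟩ := exists_transvection (linearIndependent_finCons.2 ⟨h, hq'⟩)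
  convert! ambientIsotopic_polyCarrier_transvection ![0, p, q] φ u hu using 2
  ext1 i
  fin_cases i <;> simp [hp, hq]

theorem ambientIsotopic_triangle_left {p q p' : SpaceE3} (h : LinearIndependent ℝ ![p', q, p]) :
    AmbientIsotopic (polyCarrier ![0, p, q]) (polyCarrier ![0, p', q]) := by
  obtain ⟨φ, u, hu, hp, hq⟩ := exists_transvection h
  convert! ambientIsotopic_polyCarrier_transvection ![0, p, q] φ u hu using 2
  ext1 i
  fin_cases i <;> simp [hp, hq]

theorem linearIndependent_pair_of_notMem {p q r : SpaceE3} (hq : q ≠ 0)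
    (h : p ∉ Submodule.span ℝ (Set.range ![q, r])) : LinearIndependent ℝ ![q, p] := by
  rw [LinearIndependent.pair_iff' hq]
  rintro a rfl
  exact h (Submodule.smul_mem _ _ (Submodule.subset_span ⟨0, rfl⟩))

theorem ambientIsotopic_triangles {p q p₀ q₀ : SpaceE3} (h : LinearIndependent ℝ ![p, q])
    (h₀ : LinearIndependent ℝ ![p₀, q₀]) :
    AmbientIsotopic (polyCarrier ![0, p, q]) (polyCarrier ![0, p₀, q₀]) := by
  have hp : p ≠ 0 := h.ne_zero 0
  have hq₀ : q₀ ≠ 0 := h₀.ne_zero 1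
  obtain ⟨p', hp'⟩ := exists_notMem_span_pairs ![p, q₀] ![q, p₀]
  obtain ⟨q', hq'⟩ := exists_notMem_span_pairs ![p, p, p'] ![q, p', q₀]
  have hpp' := linearIndependent_pair_of_notMem hp (hp' 0)
  have hp'q₀ := linearIndependent_pair_of_notMem hq₀ (hp' 1)
  have sw : ∀ {a b : SpaceE3}, LinearIndependent ℝ ![a, b] → LinearIndependent ℝ ![b, a] :=
    LinearIndependent.pair_symm_iff.1
  refine (ambientIsotopic_triangle_right h (hq' 0)).trans ?_
  refine AmbientIsotopic.trans (B := polyCarrier ![0, p', q']) ?_ ?_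
  · have h3 : LinearIndependent ℝ ![q', p, p'] := linearIndependent_finCons.2 ⟨hpp', hq' 1⟩
    refine ambientIsotopic_triangle_left ?_
    convert! h3.comp ![2, 0, 1] (by decide) using 1
    ext1 i
    fin_cases i <;> rfl
  refine AmbientIsotopic.trans (B := polyCarrier ![0, p', q₀]) ?_ ?_
  · exact (ambientIsotopic_triangle_right (sw hp'q₀) (hq' 2)).symm
  · refine (ambientIsotopic_triangle_left
      (linearIndependent_finCons.2 ⟨sw h₀, ?_⟩)).symm
    exact hp' 1

theorem StickKnot.linearIndependent_of_three (P : StickKnot 3) :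
    LinearIndependent ℝ ![P.vertex 1 - P.vertex 0, P.vertex 2 - P.vertex 0] := by
  have h10 : P.vertex 1 - P.vertex 0 ≠ 0 := sub_ne_zero.2 (P.vertex_ne_next 0)
  rw [LinearIndependent.pair_iff' h10]
  intro k hk
  have e0 : ∀ t, polyEdge P.vertex 0 t = P.vertex 0 + t • (P.vertex 1 - P.vertex 0) :=
    polyEdge_eq P.vertex 0
  have e1 : ∀ t, polyEdge P.vertex 1 t = P.vertex 1 + t • (P.vertex 2 - P.vertex 1) :=
    polyEdge_eq P.vertex 1
  have e2 : ∀ t, polyEdge P.vertex 2 t = P.vertex 2 + t • (P.vertex 0 - P.vertex 2) :=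
    polyEdge_eq P.vertex 2
  have h2 : P.vertex 2 = P.vertex 0 + k • (P.vertex 1 - P.vertex 0) := by rw [hk]; abel
  rcases lt_or_ge k 0 with h | h
  · have h1k : 0 < 1 - k := by linarith
    have := (P.simple 1 0 (1 / (1 - k)) ⟨by positivity, by rw [div_lt_one h1k]; linarith⟩ 0
      (by simp) (by
        rw [e1, e0, h2]
        have : P.vertex 0 + k • (P.vertex 1 - P.vertex 0) - P.vertex 1 =
          (1 - k) • (P.vertex 0 - P.vertex 1) := by module
        rw [this, smul_smul, one_div, inv_mul_cancel₀ h1k.ne']; module)).1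
    exact absurd this (by decide)
  rcases lt_or_ge k 1 with h' | h'
  · have := (P.simple 0 2 k ⟨h, h'⟩ 0 (by simp) (by rw [e0, e2, h2]; module)).1
    exact absurd this (by decide)
  · have hk0 : 0 < k := by linarith
    have := (P.simple 2 1 (1 - 1 / k) ⟨by
        rw [sub_nonneg, div_le_one hk0]; exact h', by
        have : 0 < 1 / k := by positivity
        linarith⟩ 0 (by simp) (by
        rw [e2, e1, h2]
        have : P.vertex 0 - (P.vertex 0 + k • (P.vertex 1 - P.vertex 0)) =
          k • (P.vertex 0 - P.vertex 1) := by module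
        rw [this, smul_smul, sub_mul, one_div, inv_mul_cancel₀ hk0.ne']; module)).1
    exact absurd this (by decide)

/-- The gauge of a double cone over a triangle in the horizontal coordinate plane. -/
noncomputable def triangleGauge (x : SpaceE3) : ℝ := max (x 0 + x 1) (max (-x 0) (-x 1)) + |x 2|

/-- The radial rescaling between `triangleGauge` and the Euclidean norm. -/
noncomputable def radialScale (t : ℝ) (x : SpaceE3) : ℝ := 1 - t + t * (triangleGauge x / ‖x‖)

theorem continuous_triangleGauge : Continuous triangleGauge := by
  unfold triangleGauge; fun_prop

theorem triangleGauge_smul {c : ℝ} (hc : 0 ≤ c) (x : SpaceE3) :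
    triangleGauge (c • x) = c * triangleGauge x := by
  simp only [triangleGauge, PiLp.smul_apply, smul_eq_mul, abs_mul, abs_of_nonneg hc, mul_add,
    mul_max_of_nonneg _ _ hc, mul_neg]

theorem radialScale_smul (t : ℝ) {c : ℝ} (hc : 0 < c) (x : SpaceE3) :
    radialScale t (c • x) = radialScale t x := by
  rw [radialScale, radialScale, triangleGauge_smul hc.le, norm_smul, Real.norm_of_nonneg hc.le,
    mul_div_mul_left _ _ hc.ne']

theorem norm_le_triangleGauge (x : SpaceE3) : ‖x‖ ≤ 5 * triangleGauge x := by
  have h0 : x 0 + x 1 ≤ max (x 0 + x 1) (max (-x 0) (-x 1)) := le_max_left _ _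
  have h1 : -x 0 ≤ max (x 0 + x 1) (max (-x 0) (-x 1)) :=
    (le_max_left _ _).trans (le_max_right _ _)
  have h2 : -x 1 ≤ max (x 0 + x 1) (max (-x 0) (-x 1)) :=
    (le_max_right _ _).trans (le_max_right _ _)
  unfold triangleGauge
  generalize max (x 0 + x 1) (max (-x 0) (-x 1)) = N at *
  have hz := abs_nonneg (x 2)
  have hN : 0 ≤ N := by linarith
  have b0 : |x 0| ≤ 2 * N := abs_le.2 ⟨by linarith, by linarith⟩
  have b1 : |x 1| ≤ 2 * N := abs_le.2 ⟨by linarith, by linarith⟩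
  rw [EuclideanSpace.norm_eq]
  refine Real.sqrt_le_iff.2 ⟨by positivity, ?_⟩
  simp only [Fin.sum_univ_three, Real.norm_eq_abs]
  nlinarith [abs_nonneg (x 0), abs_nonneg (x 1), mul_nonneg hN hz]

theorem abs_apply_le_norm (x : SpaceE3) (i : Fin 3) : |x i| ≤ ‖x‖ := PiLp.norm_apply_le x i

theorem triangleGauge_le_norm (x : SpaceE3) : triangleGauge x ≤ 3 * ‖x‖ := by
  have h0 := abs_le.1 (abs_apply_le_norm x 0)
  have h1 := abs_le.1 (abs_apply_le_norm x 1)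
  have h2 := abs_apply_le_norm x 2
  have : max (x 0 + x 1) (max (-x 0) (-x 1)) ≤ 2 * ‖x‖ :=
    max_le (by linarith) (max_le (by linarith) (by linarith))
  unfold triangleGauge
  linarith

theorem radialScale_bounds {t : ℝ} (ht0 : 0 ≤ t) (ht1 : t ≤ 1) {x : SpaceE3} (hx : x ≠ 0) :
    1 / 5 ≤ radialScale t x ∧ radialScale t x ≤ 3 := by
  have hx' : 0 < ‖x‖ := norm_pos_iff.2 hx
  have h1 : 1 / 5 ≤ triangleGauge x / ‖x‖ := by
    rw [le_div_iff₀ hx']; linarith [norm_le_triangleGauge x]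
  have h2 : triangleGauge x / ‖x‖ ≤ 3 := by
    rw [div_le_iff₀ hx']; exact triangleGauge_le_norm x
  unfold radialScale
  constructor <;> nlinarith

theorem continuous_smul_of_bounded {X : Type*} [TopologicalSpace X] (σ : X → SpaceE3 → ℝ) (C : ℝ)
    (hb : ∀ t x, x ≠ 0 → |σ t x| ≤ C)
    (hc : ∀ t x, x ≠ 0 → ContinuousAt (fun p : X × SpaceE3 => σ p.1 p.2) (t, x)) :
    Continuous fun p : X × SpaceE3 => σ p.1 p.2 • p.2 := by
  rw [continuous_iff_continuousAt]
  rintro ⟨t, x⟩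
  by_cases hx : x = 0
  · subst hx
    rw [ContinuousAt, smul_zero, tendsto_zero_iff_norm_tendsto_zero]
    have hlim : Filter.Tendsto (fun p : X × SpaceE3 => C * ‖p.2‖) (nhds (t, 0)) (nhds 0) := by
      have : Continuous (fun p : X × SpaceE3 => C * ‖p.2‖) := by fun_prop
      simpa using this.tendsto (t, 0)
    refine squeeze_zero (fun _ => norm_nonneg _) (fun p => ?_) hlim
    by_cases hp : p.2 = 0
    · simp [hp]
    · rw [norm_smul, Real.norm_eq_abs]
      exact mul_le_mul_of_nonneg_right (hb _ _ hp) (norm_nonneg _)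
  · exact (hc t x hx).smul continuousAt_snd

theorem continuousAt_radialScale (t : unitInterval) {x : SpaceE3} (hx : x ≠ 0) :
    ContinuousAt (fun p : unitInterval × SpaceE3 => radialScale p.1 p.2) (t, x) := by
  have h1 : ContinuousAt (fun p : unitInterval × SpaceE3 => triangleGauge p.2) (t, x) :=
    (continuous_triangleGauge.comp continuous_snd).continuousAt
  have h2 : ContinuousAt (fun p : unitInterval × SpaceE3 => ‖p.2‖) (t, x) :=
    (continuous_norm.comp continuous_snd).continuousAt
  have h3 : ContinuousAt (fun p : unitInterval × SpaceE3 => (p.1 : ℝ)) (t, x) :=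
    (continuous_subtype_val.comp continuous_fst).continuousAt
  exact (continuousAt_const.sub h3).add (h3.mul (h1.div h2 (norm_ne_zero_iff.2 hx)))

theorem ambientIsotopic_radialScale (A : Set SpaceE3) :
    AmbientIsotopic A ((fun x => (triangleGauge x / ‖x‖) • x) '' A) := by
  have hpos : ∀ (t : unitInterval) (x : SpaceE3), x ≠ 0 → 0 < radialScale t x := fun t x hx => by
    linarith [(radialScale_bounds t.2.1 t.2.2 hx).1]
  have := AmbientIsotopic.of_family (fun t x => radialScale t x • x)
    (fun t x => (radialScale t x)⁻¹ • x) ?_ ?_ ?_ ?_ ?_ A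
  · simpa [radialScale] using this
  · refine continuous_smul_of_bounded (fun (t : unitInterval) x => radialScale t x) 3
      (fun t x hx => ?_) fun t x hx => continuousAt_radialScale t hx
    rw [abs_of_pos (hpos t x hx)]
    exact (radialScale_bounds t.2.1 t.2.2 hx).2
  · refine continuous_smul_of_bounded (fun (t : unitInterval) x => (radialScale t x)⁻¹) 5
      (fun t x hx => ?_) fun t x hx => (continuousAt_radialScale t hx).inv₀ (hpos t x hx).ne'
    rw [abs_of_pos (inv_pos.2 (hpos t x hx))]
    refine inv_le_of_inv_le₀ (by norm_num) ?_
    have := (radialScale_bounds t.2.1 t.2.2 hx).1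
    linarith
  · intro t x
    by_cases hx : x = 0
    · simp [hx]
    · have := hpos t x hx
      simp only [radialScale_smul t (inv_pos.2 this), smul_smul, mul_inv_cancel₀ this.ne', one_smul]
  · intro t x
    by_cases hx : x = 0
    · simp [hx]
    · have := hpos t x hx
      simp only [radialScale_smul t this, smul_smul, inv_mul_cancel₀ this.ne', one_smul]
  · intro x; simp [radialScale]

theorem polyCarrier_standardTriangle :
    polyCarrier ![!₂[-1, -1, 0], !₂[2, -1, 0], !₂[-1, 2, 0]] =
      {x | triangleGauge x = 1 ∧ x 2 = 0} := by
  have r0 : finRotate 3 0 = 1 := by decide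
  have r1 : finRotate 3 1 = 2 := by decide
  have r2 : finRotate 3 2 = 0 := by decide
  ext x
  constructor
  · rintro ⟨i, t, ⟨ht0, ht1⟩, rfl⟩
    fin_cases i <;>
      simp only [Set.mem_ofPred_eq, triangleGauge, polyEdge_apply, Fin.zero_eta, Fin.mk_one,
        Fin.reduceFinMk, r0, r1, r2] <;>
      simp <;> ring_nf
    · rw [max_eq_right (le_max_of_le_right (by linarith)), max_eq_right (by linarith)]
    · rw [max_eq_left (max_le (by linarith) (by linarith))]
    · rw [max_eq_right (le_max_of_le_left (by linarith)), max_eq_left (by linarith)]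
  · rintro ⟨h, h2⟩
    simp only [triangleGauge, h2, abs_zero, add_zero] at h
    have h0 : x 0 + x 1 ≤ 1 := h ▸ le_max_left _ _
    have h1 : -x 0 ≤ 1 := h ▸ (le_max_left _ _).trans (le_max_right _ _)
    have h3 : -x 1 ≤ 1 := h ▸ (le_max_right _ _).trans (le_max_right _ _)
    have hcase : x 1 = -1 ∨ x 0 + x 1 = 1 ∨ x 0 = -1 := by
      rcases max_choice (x 0 + x 1) (max (-x 0) (-x 1)) with e | e
      · right; left; linarith
      · rcases max_choice (-x 0) (-x 1) with e' | e'
        · right; right; linarith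
        · left; linarith
    rcases hcase with e | e | e
    · refine ⟨0, (x 0 + 1) / 3, ⟨by linarith, by linarith⟩, ?_⟩
      ext j
      fin_cases j <;> simp [polyEdge_apply, -finRotate_apply, r0, h2, e] <;> linarith
    · refine ⟨1, (2 - x 0) / 3, ⟨by linarith, by linarith⟩, ?_⟩
      ext j
      fin_cases j <;> simp [polyEdge_apply, -finRotate_apply, r1, h2] <;> linarith
    · refine ⟨2, (2 - x 1) / 3, ⟨by linarith, by linarith⟩, ?_⟩
      ext j
      fin_cases j <;> simp [polyEdge_apply, -finRotate_apply, r2, h2, e] <;> linarith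

theorem ambientIsotopic_standardTriangle_roundCircle :
    AmbientIsotopic (polyCarrier ![!₂[-1, -1, 0], !₂[2, -1, 0], !₂[-1, 2, 0]]) roundCircle := by
  convert! ambientIsotopic_radialScale _
  rw [polyCarrier_standardTriangle]
  ext y
  constructor
  · rintro ⟨h, h2⟩
    have hn : ‖y‖ = 1 := by
      rw [EuclideanSpace.norm_eq, Fin.sum_univ_three]
      simp [h2, h]
    have hg : 0 < triangleGauge y := by linarith [norm_le_triangleGauge y]
    refine ⟨(triangleGauge y)⁻¹ • y, ⟨?_, by simp [h2]⟩, ?_⟩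
    · rw [triangleGauge_smul (inv_pos.2 hg).le, inv_mul_cancel₀ hg.ne']
    · simp only [triangleGauge_smul (inv_pos.2 hg).le, inv_mul_cancel₀ hg.ne', norm_smul, hn,
        smul_smul, Real.norm_of_nonneg (inv_pos.2 hg).le]
      field_simp
      simp
  · rintro ⟨x, ⟨h, h2⟩, rfl⟩
    have hx : 0 < ‖x‖ := by
      rw [norm_pos_iff]; rintro rfl; simp [triangleGauge] at h
    have hn : ‖x‖ ^ 2 = x 0 ^ 2 + x 1 ^ 2 := by
      rw [EuclideanSpace.norm_sq_eq, Fin.sum_univ_three]; simp [h2]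
    refine ⟨?_, by simp [h2]⟩
    simp only [h, PiLp.smul_apply, smul_eq_mul]
    field_simp
    linarith

theorem StickKnot.isUnknot_of_three (P : StickKnot 3) : IsUnknot P.carrier := by
  have h₀ : LinearIndependent ℝ ![(!₂[3, 0, 0] : SpaceE3), !₂[0, 3, 0]] := by
    rw [LinearIndependent.pair_iff]
    intro a b h
    have h0 := congrArg (fun x : SpaceE3 => x 0) h
    have h1 := congrArg (fun x : SpaceE3 => x 1) h
    simpa using And.intro h0 h1
  have s1 := ambientIsotopic_polyCarrier_translation P.vertex (-P.vertex 0)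
  have e1 : (fun i => P.vertex i + -P.vertex 0) =
      ![0, P.vertex 1 - P.vertex 0, P.vertex 2 - P.vertex 0] := by
    ext1 i; fin_cases i <;> simp [sub_eq_add_neg]
  rw [e1] at s1
  have s2 := ambientIsotopic_triangles P.linearIndependent_of_three h₀
  have s3 := ambientIsotopic_polyCarrier_translation
    ![0, (!₂[3, 0, 0] : SpaceE3), !₂[0, 3, 0]] !₂[-1, -1, 0]
  have e3 : (fun i => ![0, (!₂[3, 0, 0] : SpaceE3), !₂[0, 3, 0]] i + !₂[-1, -1, 0]) =
      ![!₂[-1, -1, 0], !₂[2, -1, 0], !₂[-1, 2, 0]] := by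
    ext i j; fin_cases i <;> fin_cases j <;> norm_num
  rw [e3] at s3
  exact (((s1.trans s2).trans s3).trans ambientIsotopic_standardTriangle_roundCircle).symm

/-! ### Projecting along a stick -/

theorem StickKnot.exists_transvection_eq {n : ℕ} (P : StickKnot n) (φ : SpaceE3 →L[ℝ] ℝ)
    (u : SpaceE3) (hu : φ u = 0) :
    ∃ Q : StickKnot n, (Q.vertex = fun i => P.vertex i + φ (P.vertex i) • u) ∧
      AmbientIsotopic P.carrier Q.carrier := by
  have he : ∀ i t, polyEdge (fun i => P.vertex i + φ (P.vertex i) • u) i t =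
      polyEdge P.vertex i t + φ (polyEdge P.vertex i t) • u := fun i t => by
    simp only [polyEdge_eq, map_add, map_smul, map_sub, smul_eq_mul]; module
  refine ⟨⟨_, P.three_le, fun i j s hs t ht h => P.simple i j s hs t ht ?_⟩, rfl,
    ambientIsotopic_polyCarrier_transvection P.vertex φ u hu⟩
  rw [he, he] at h
  have h' := congrArg φ h
  simp only [map_add, map_smul, hu, smul_zero, add_zero] at h'
  rw [h'] at h
  exact add_right_cancel h

theorem exists_transvection_vertical {e : SpaceE3} (he : e ≠ 0) :
    ∃ (φ : SpaceE3 →L[ℝ] ℝ) (u : SpaceE3), φ u = 0 ∧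
      (e + φ e • u) 0 = 0 ∧ (e + φ e • u) 1 = 0 := by
  obtain ⟨φ, hφe, hφ⟩ : ∃ φ : SpaceE3 →L[ℝ] ℝ, φ e ≠ 0 ∧ φ !₂[0, 0, 1] = 1 := by
    by_cases h2 : e 2 = 0
    · by_cases h1 : e 1 = 0
      · have h0 : e 0 ≠ 0 := fun h0 => he (by ext i; fin_cases i <;> simpa)
        exact ⟨EuclideanSpace.proj 2 + EuclideanSpace.proj 0, by simpa [h2], by simp⟩
      · exact ⟨EuclideanSpace.proj 2 + EuclideanSpace.proj 1, by simpa [h2], by simp⟩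
    · exact ⟨EuclideanSpace.proj 2, by simpa, by simp⟩
  refine ⟨φ, !₂[0, 0, 1] - (φ e)⁻¹ • e, by simp [hφ, hφe], ?_, ?_⟩ <;>
    simp [hφe]

/-- Every stick knot can be sheared so that its next to last stick is vertical. -/
theorem StickKnot.exists_vertical {k : ℕ} (P : StickKnot (k + 2)) :
    ∃ Q : StickKnot (k + 2), AmbientIsotopic P.carrier Q.carrier ∧
      Q.vertex (Fin.last (k + 1)) 0 = Q.vertex (Fin.last k).castSucc 0 ∧
      Q.vertex (Fin.last (k + 1)) 1 = Q.vertex (Fin.last k).castSucc 1 := by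
  have hr : finRotate (k + 2) (Fin.last k).castSucc = Fin.last (k + 1) := by
    rw [Fin.ext_iff, val_finRotate]; simp
  have he := P.vertex_ne_next (Fin.last k).castSucc
  rw [hr] at he
  obtain ⟨φ, u, hu, h0, h1⟩ := exists_transvection_vertical (sub_ne_zero.2 he)
  obtain ⟨Q, hQ, hPQ⟩ := P.exists_transvection_eq φ u hu
  refine ⟨Q, hPQ, ?_, ?_⟩ <;> rw [hQ]
  · simp only [map_sub, PiLp.add_apply, PiLp.sub_apply, PiLp.smul_apply, smul_eq_mul] at h0 ⊢
    linarith
  · simp only [map_sub, PiLp.add_apply, PiLp.sub_apply, PiLp.smul_apply, smul_eq_mul] at h1 ⊢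
    linarith

/-- A closed polygon in general position together with a height function that separates the
edges at each crossing gives a planar stick diagram. -/
theorem InGeneralPosition.exists_diagram {m : ℕ} (hm : 3 ≤ m) {w : Fin m → PlaneE2}
    (hw : InGeneralPosition w) (h : Fin m → ℝ → ℝ)
    (hcont : ∀ i, ContinuousOn (h i) (Set.Icc 0 1))
    (hclosed : ∀ i, h i 1 = h (finRotate m i) 0)
    (hne : ∀ i j, EdgesCross w i j → ∀ s ∈ Set.Icc (0 : ℝ) 1, ∀ t ∈ Set.Icc (0 : ℝ) 1,
      polyEdge w i s = polyEdge w j t → h i s ≠ h j t) :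
    ∃ D : PlanarStickDiagram m, D.vertex = w ∧ D.IsHeight h := by
  refine ⟨{ vertex := w
            three_le := hm
            vertex_notMem_edge := fun i j hij hij' t _ => hw.vertex_ne_polyEdge hm hij hij' t
            no_triple_point := fun i j k hij hik hjk r _ s _ t _ hp =>
              hw.no_triple_point hm hij hik hjk hp.1 hp.2
            isOver := fun i j => ∀ s ∈ Set.Icc (0 : ℝ) 1, ∀ t ∈ Set.Icc (0 : ℝ) 1,
              polyEdge w i s = polyEdge w j t → h j t < h i s
            isOver_iff := ?_ }, rfl, hcont, hclosed, fun i j _ hij => hij⟩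
  intro i j hc
  obtain ⟨hij, hi, hj, s, hs, t, ht, hst⟩ := id hc
  constructor
  · intro h1 h2
    exact lt_asymm (h1 s hs t ht hst) (h2 t ht s hs hst.symm)
  · intro h1 s' hs' t' ht' hst'
    by_contra h2
    refine h1 fun t'' ht'' s'' hs'' hst'' => ?_
    obtain ⟨rfl, rfl⟩ := hw.crossing_unique hm hij hj hst' hst''.symm
    exact lt_of_le_of_ne (not_lt.1 h2) (hne i j hc _ hs' _ ht' hst')

section lift

variable {k : ℕ} (w : Fin (k + 1) → PlaneE2) (z : Fin (k + 2) → ℝ) (δ : ℝ)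

/-- The height function of the projected polygon; over the last edge it first climbs to the last
height, up to the parameter `δ`. -/
noncomputable def edgeHeight (i : Fin (k + 1)) (t : ℝ) : ℝ :=
  if i = Fin.last k then
    if t ≤ δ then z (Fin.last k).castSucc +
      t / δ * (z (Fin.last (k + 1)) - z (Fin.last k).castSucc)
    else z (Fin.last (k + 1)) + (t - δ) / (1 - δ) * (z 0 - z (Fin.last (k + 1)))
  else z i.castSucc + t * (z (finRotate (k + 1) i).castSucc - z i.castSucc)

/-- The point with height `edgeHeight` above the point with parameter `t` of the `i`-th edge. -/
noncomputable def liftedPoint (i : Fin (k + 1)) (t : ℝ) : SpaceE3 :=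
  !₂[polyEdge w i t 0, polyEdge w i t 1, edgeHeight z δ i t]

/-- The vertices of the polygon formed by the points `liftedPoint`. -/
noncomputable def liftedVertex : Fin (k + 2) → SpaceE3 :=
  Fin.snoc (α := fun _ => SpaceE3) (fun i => !₂[w i 0, w i 1, z i.castSucc])
    !₂[polyEdge w (Fin.last k) δ 0, polyEdge w (Fin.last k) δ 1, z (Fin.last (k + 1))]

theorem liftedVertex_castSucc (i : Fin (k + 1)) :
    liftedVertex w z δ i.castSucc = !₂[w i 0, w i 1, z i.castSucc] := by
  simp [liftedVertex]

theorem liftedVertex_last : liftedVertex w z δ (Fin.last (k + 1)) =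
    !₂[polyEdge w (Fin.last k) δ 0, polyEdge w (Fin.last k) δ 1, z (Fin.last (k + 1))] := by
  simp [liftedVertex]

theorem finRotate_last_zero : finRotate (k + 1) (Fin.last k) = 0 := by
  rw [Fin.ext_iff, val_finRotate]; simp

theorem finRotate_castSucc_of_ne {i : Fin (k + 1)} (hi : i ≠ Fin.last k) :
    finRotate (k + 2) i.castSucc = (finRotate (k + 1) i).castSucc := by
  have : (i : ℕ) ≠ k := fun h => hi (Fin.ext h)
  rw [Fin.ext_iff, val_finRotate, Fin.val_castSucc, Fin.val_castSucc, val_finRotate]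
  split_ifs <;> omega

theorem finRotate_castSucc_last :
    finRotate (k + 2) (Fin.last k).castSucc = Fin.last (k + 1) := by
  rw [Fin.ext_iff, val_finRotate]; simp

theorem polyEdge_liftedVertex_of_ne {i : Fin (k + 1)} (hi : i ≠ Fin.last k) (t : ℝ) :
    polyEdge (liftedVertex w z δ) i.castSucc t = liftedPoint w z δ i t := by
  ext j
  rw [polyEdge_apply, finRotate_castSucc_of_ne hi, liftedVertex_castSucc, liftedVertex_castSucc,
    liftedPoint, edgeHeight, if_neg hi]
  fin_cases j <;> simp [polyEdge_apply, -finRotate_apply]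

theorem polyEdge_liftedVertex_castSucc_last (hδ : 0 < δ) {t : ℝ} (ht : t ≤ 1) :
    polyEdge (liftedVertex w z δ) (Fin.last k).castSucc t =
      liftedPoint w z δ (Fin.last k) (δ * t) := by
  have h1 : δ * t ≤ δ := by nlinarith
  ext j
  rw [polyEdge_apply, finRotate_castSucc_last, liftedVertex_castSucc, liftedVertex_last,
    liftedPoint, edgeHeight, if_pos rfl, if_pos h1, mul_div_cancel_left₀ _ hδ.ne']
  fin_cases j <;> simp [polyEdge_apply, -finRotate_apply] <;> ring

theorem polyEdge_liftedVertex_last (hδ0 : 0 < δ) (hδ : δ < 1) {t : ℝ} (ht : 0 ≤ t) :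
    polyEdge (liftedVertex w z δ) (Fin.last (k + 1)) t =
      liftedPoint w z δ (Fin.last k) (δ + (1 - δ) * t) := by
  have hδ' : 0 < 1 - δ := sub_pos.2 hδ
  have hh : edgeHeight z δ (Fin.last k) (δ + (1 - δ) * t) =
      z (Fin.last (k + 1)) + t * (z 0 - z (Fin.last (k + 1))) := by
    rw [edgeHeight, if_pos rfl]
    rcases ht.eq_or_lt with rfl | ht
    · rw [if_pos (by simp), mul_zero, add_zero, div_self hδ0.ne']; ring
    · rw [if_neg (by nlinarith), add_sub_cancel_left, mul_div_cancel_left₀ _ hδ'.ne']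
  have h0 : liftedVertex w z δ 0 = !₂[w 0 0, w 0 1, z 0] := liftedVertex_castSucc w z δ 0
  ext j
  rw [polyEdge_apply, finRotate_last_zero, h0, liftedVertex_last, liftedPoint, hh]
  fin_cases j <;> simp [polyEdge_apply, -finRotate_apply,
    finRotate_last_zero] <;> ring

theorem polyCarrier_liftedVertex (hδ0 : 0 < δ) (hδ1 : δ < 1) :
    polyCarrier (liftedVertex w z δ) =
      {x | ∃ i, ∃ t ∈ Set.Icc (0 : ℝ) 1, x = liftedPoint w z δ i t} := by
  have hδ' : 0 < 1 - δ := sub_pos.2 hδ1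
  ext x
  constructor
  · rintro ⟨i, t, ⟨ht0, ht1⟩, rfl⟩
    refine Fin.lastCases ?_ (fun i => ?_) i
    · rw [polyEdge_liftedVertex_last w z δ hδ0 hδ1 ht0]
      exact ⟨_, _, ⟨by positivity, by nlinarith⟩, rfl⟩
    · by_cases hi : i = Fin.last k
      · subst hi
        rw [polyEdge_liftedVertex_castSucc_last w z δ hδ0 ht1]
        exact ⟨_, _, ⟨by positivity, by nlinarith⟩, rfl⟩
      · rw [polyEdge_liftedVertex_of_ne w z δ hi]
        exact ⟨i, t, ⟨ht0, ht1⟩, rfl⟩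
  · rintro ⟨i, t, ⟨ht0, ht1⟩, rfl⟩
    by_cases hi : i = Fin.last k
    · subst hi
      rcases le_or_gt t δ with h | h
      · have h1 : t / δ ≤ 1 := (div_le_one hδ0).2 h
        refine ⟨(Fin.last k).castSucc, t / δ, ⟨by positivity, h1⟩, ?_⟩
        rw [polyEdge_liftedVertex_castSucc_last w z δ hδ0 h1, mul_div_cancel₀ _ hδ0.ne']
      · have h0 : 0 ≤ (t - δ) / (1 - δ) := div_nonneg (by linarith) hδ'.le
        refine ⟨Fin.last (k + 1), (t - δ) / (1 - δ),
          ⟨h0, (div_le_one hδ').2 (by linarith)⟩, ?_⟩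
        rw [polyEdge_liftedVertex_last w z δ hδ0 hδ1 h0, mul_div_cancel₀ _ hδ'.ne', add_sub_cancel]
    · exact ⟨i.castSucc, t, ⟨ht0, ht1⟩, (polyEdge_liftedVertex_of_ne w z δ hi t).symm⟩

theorem exists_polyEdge_liftedVertex_eq (hδ0 : 0 < δ) (hδ1 : δ < 1) (i : Fin (k + 1)) {t : ℝ}
    (ht : t ∈ Set.Ico (0 : ℝ) 1) :
    ∃ i', (i' = i.castSucc ∨ i' = Fin.last (k + 1) ∧ i = Fin.last k) ∧
      ∃ t' ∈ Set.Ico (0 : ℝ) 1, polyEdge (liftedVertex w z δ) i' t' = liftedPoint w z δ i t := by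
  have hδ' : 0 < 1 - δ := sub_pos.2 hδ1
  obtain ⟨ht0, ht1⟩ := ht
  by_cases hi : i = Fin.last k
  · subst hi
    rcases lt_or_ge t δ with h | h
    · have h1 : t / δ < 1 := (div_lt_one hδ0).2 h
      refine ⟨(Fin.last k).castSucc, Or.inl rfl, t / δ, ⟨by positivity, h1⟩, ?_⟩
      rw [polyEdge_liftedVertex_castSucc_last w z δ hδ0 h1.le, mul_div_cancel₀ _ hδ0.ne']
    · have h0 : 0 ≤ (t - δ) / (1 - δ) := div_nonneg (by linarith) hδ'.le
      refine ⟨Fin.last (k + 1), Or.inr ⟨rfl, rfl⟩, (t - δ) / (1 - δ),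
        ⟨h0, (div_lt_one hδ').2 (by linarith)⟩, ?_⟩
      rw [polyEdge_liftedVertex_last w z δ hδ0 hδ1 h0, mul_div_cancel₀ _ hδ'.ne', add_sub_cancel]
  · exact ⟨i.castSucc, Or.inl rfl, t, ⟨ht0, ht1⟩, polyEdge_liftedVertex_of_ne w z δ hi t⟩

theorem continuous_edgeHeight (hδ0 : 0 < δ) (i : Fin (k + 1)) : Continuous (edgeHeight z δ i) := by
  unfold edgeHeight
  split_ifs with hi
  · refine Continuous.if_le (by fun_prop) (by fun_prop) (by fun_prop) (by fun_prop) ?_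
    rintro t rfl
    rw [div_self hδ0.ne', sub_self]; ring
  · fun_prop

theorem edgeHeight_zero (hδ0 : 0 < δ) (i : Fin (k + 1)) : edgeHeight z δ i 0 = z i.castSucc := by
  unfold edgeHeight
  split_ifs with hi h
  · simp [hi]
  · exact absurd hδ0.le h
  · simp

theorem edgeHeight_one (hδ1 : δ < 1) (i : Fin (k + 1)) :
    edgeHeight z δ i 1 = z (finRotate (k + 1) i).castSucc := by
  unfold edgeHeight
  split_ifs with hi h
  · linarith
  · rw [div_self (sub_pos.2 hδ1).ne', hi, finRotate_last_zero]; simp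
  · ring

theorem InGeneralPosition.exists_diagram_of_lift (hk : 2 ≤ k) {w : Fin (k + 1) → PlaneE2}
    (hw : InGeneralPosition w) {δ : ℝ} (hδ0 : 0 < δ) (hδ1 : δ < 1) (Q : StickKnot (k + 2))
    (hQ : Q.vertex = liftedVertex w z δ) :
    ∃ D : PlanarStickDiagram (k + 1), D.Represents Q.carrier := by
  have hm : 3 ≤ k + 1 := by omega
  obtain ⟨D, hD, hh⟩ := hw.exists_diagram hm (edgeHeight z δ)
    (fun i => (continuous_edgeHeight z δ hδ0 i).continuousOn)
    (fun i => by rw [edgeHeight_one z δ hδ1, edgeHeight_zero z δ hδ0]) (by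
      rintro i j ⟨hij, hi, hj, -⟩ s hs t ht hst hEq
      have hs1 : s < 1 := by
        refine lt_of_le_of_ne hs.2 ?_
        rintro rfl
        rw [polyEdge_one] at hst
        exact hw.vertex_ne_polyEdge hm hj.symm ((finRotate _).injective.ne hij) t hst
      have ht1 : t < 1 := by
        refine lt_of_le_of_ne ht.2 ?_
        rintro rfl
        rw [polyEdge_one] at hst
        exact hw.vertex_ne_polyEdge hm hi.symm ((finRotate _).injective.ne hij.symm) s hst.symm
      have hp : liftedPoint w z δ i s = liftedPoint w z δ j t := by
        rw [liftedPoint, liftedPoint, hst, hEq]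
      obtain ⟨i', hi', s', hs', e⟩ := exists_polyEdge_liftedVertex_eq w z δ hδ0 hδ1 i ⟨hs.1, hs1⟩
      obtain ⟨j', hj', t', ht', e'⟩ := exists_polyEdge_liftedVertex_eq w z δ hδ0 hδ1 j ⟨ht.1, ht1⟩
      have := (Q.simple i' j' s' hs' t' ht' (by rw [hQ, e, e', hp])).1
      subst this
      rcases hi' with rfl | ⟨rfl, rfl⟩ <;> rcases hj' with h | ⟨h, h'⟩
      · exact hij (Fin.castSucc_injective _ h)
      · exact Fin.castSucc_ne_last _ h
      · exact Fin.castSucc_ne_last _ h.symm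
      · exact hij h'.symm)
  refine ⟨D, edgeHeight z δ, hh, ?_⟩
  have : D.lift (edgeHeight z δ) = Q.carrier := by
    have : Q.carrier = polyCarrier (liftedVertex w z δ) := by rw [← hQ]; rfl
    rw [this, polyCarrier_liftedVertex w z δ hδ0 hδ1, PlanarStickDiagram.lift, hD]
    rfl
  rw [this]
  exact AmbientIsotopic.refl _

end lift

theorem norm_vec3_le (a b c : ℝ) : ‖(!₂[a, b, c] : SpaceE3)‖ ≤ |a| + |b| + |c| := by
  rw [EuclideanSpace.norm_eq]
  refine Real.sqrt_le_iff.2 ⟨by positivity, ?_⟩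
  simp only [Fin.sum_univ_three, Real.norm_eq_abs]
  simp
  nlinarith [abs_nonneg a, abs_nonneg b, abs_nonneg c, sq_abs a, sq_abs b, sq_abs c,
    mul_nonneg (abs_nonneg a) (abs_nonneg b), mul_nonneg (abs_nonneg a) (abs_nonneg c),
    mul_nonneg (abs_nonneg b) (abs_nonneg c)]

/-- Projecting a stick knot with at least four sticks along one of its sticks. -/
theorem StickKnot.exists_diagram {k : ℕ} (hk : 2 ≤ k) (P : StickKnot (k + 2)) :
    ∃ D : PlanarStickDiagram (k + 1), D.Represents P.carrier := by
  obtain ⟨Q, hPQ, h0, h1⟩ := P.exists_vertical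
  obtain ⟨ε, hε, hstable⟩ := Q.exists_stable
  obtain ⟨w, hw, hclose⟩ := exists_inGeneralPosition_near
    (fun i : Fin (k + 1) => (!₂[Q.vertex i.castSucc 0, Q.vertex i.castSucc 1] : PlaneE2))
    (show 0 < ε / 4 by positivity)
  have hcoord : ∀ i, |w i 0 - Q.vertex i.castSucc 0| ≤ ε / 4 ∧
      |w i 1 - Q.vertex i.castSucc 1| ≤ ε / 4 := fun i => by
    have a0 := (PiLp.norm_apply_le _ 0).trans (hclose i).le
    have a1 := (PiLp.norm_apply_le _ 1).trans (hclose i).le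
    simp only [PiLp.sub_apply, Real.norm_eq_abs] at a0 a1
    exact ⟨by simpa using a0, by simpa using a1⟩
  set M := |w 0 0 - w (Fin.last k) 0| + |w 0 1 - w (Fin.last k) 1| with hM
  have hM0 : 0 ≤ M := by positivity
  set δ := ε / 4 / (M + 1 + ε / 4) with hδ
  have hden : 0 < M + 1 + ε / 4 := by positivity
  have hδ0 : 0 < δ := by positivity
  have hδ1 : δ < 1 := by rw [hδ, div_lt_one hden]; linarith
  have hδM : δ * M ≤ ε / 4 := by
    rw [hδ, div_mul_eq_mul_div, div_le_iff₀ hden]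
    exact mul_le_mul_of_nonneg_left (by linarith) (by positivity)
  obtain ⟨⟨R, hR⟩, hQR⟩ := hstable (liftedVertex w (fun i => Q.vertex i 2) δ) (by
    intro i
    refine Fin.lastCases ?_ (fun i => ?_) i
    · obtain ⟨c0, c1⟩ := hcoord (Fin.last k)
      rw [← h0] at c0
      rw [← h1] at c1
      have e : liftedVertex w (fun i => Q.vertex i 2) δ (Fin.last (k + 1)) -
          Q.vertex (Fin.last (k + 1)) =
          !₂[(w (Fin.last k) 0 - Q.vertex (Fin.last (k + 1)) 0) +
              δ * (w 0 0 - w (Fin.last k) 0),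
            (w (Fin.last k) 1 - Q.vertex (Fin.last (k + 1)) 1) +
              δ * (w 0 1 - w (Fin.last k) 1), 0] := by
        ext j
        rw [liftedVertex_last]
        fin_cases j <;> simp [polyEdge_apply, -finRotate_apply,
          finRotate_last_zero] <;> ring
      rw [e]
      refine (norm_vec3_le _ _ _).trans ?_
      have d0 := abs_add_le (w (Fin.last k) 0 - Q.vertex (Fin.last (k + 1)) 0)
        (δ * (w 0 0 - w (Fin.last k) 0))
      have d1 := abs_add_le (w (Fin.last k) 1 - Q.vertex (Fin.last (k + 1)) 1)
        (δ * (w 0 1 - w (Fin.last k) 1))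
      rw [abs_mul, abs_of_pos hδ0] at d0 d1
      rw [hM, mul_add] at hδM
      rw [abs_zero]
      linarith
    · obtain ⟨c0, c1⟩ := hcoord i
      have e : liftedVertex w (fun i => Q.vertex i 2) δ i.castSucc - Q.vertex i.castSucc =
          !₂[w i 0 - Q.vertex i.castSucc 0, w i 1 - Q.vertex i.castSucc 1, 0] := by
        ext j
        rw [liftedVertex_castSucc]
        fin_cases j <;> simp
      rw [e]
      refine (norm_vec3_le _ _ _).trans ?_
      rw [abs_zero]
      linarith)
  obtain ⟨D, h, hh, hD⟩ := hw.exists_diagram_of_lift (fun i => Q.vertex i 2) hk hδ0 hδ1 R hR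
  have hRc : R.carrier = polyCarrier (liftedVertex w (fun i => Q.vertex i 2) δ) := by
    rw [← hR]; rfl
  rw [← hRc] at hQR
  exact ⟨D, h, hh, hD.trans (hPQ.trans hQR).symm⟩

theorem mainTheorem12 (K : Set SpaceE3) (hK : IsTameKnot K) (hnontrivial : ¬ IsUnknot K) :
    planarStickIndex K + 1 ≤ stickIndex K := by
  obtain ⟨n, hn, P, hP⟩ : stickIndex K ∈
      {m : ℕ∞ | ∃ n : ℕ, m = n ∧ ∃ P : StickKnot n, AmbientIsotopic P.carrier K} := by
    obtain ⟨n, P, hP⟩ := hK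
    exact csInf_mem ⟨n, n, rfl, P, hP⟩
  rw [hn]
  have h3 := P.three_le
  have hne : n ≠ 3 := by
    rintro rfl
    exact hnontrivial (P.isUnknot_of_three.trans hP)
  obtain ⟨k, rfl⟩ : ∃ k, n = k + 2 := ⟨n - 2, by omega⟩
  obtain ⟨D, h, hh, hD⟩ := P.exists_diagram (by omega)
  have hle : planarStickIndex K ≤ ((k + 1 : ℕ) : ℕ∞) :=
    sInf_le ⟨k + 1, rfl, D, h, hh, hD.trans hP⟩
  calc planarStickIndex K + 1 ≤ ((k + 1 : ℕ) : ℕ∞) + 1 := by gcongr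
    _ = ((k + 2 : ℕ) : ℕ∞) := by push_cast; ring
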